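/- Let $L\ge 1$ be odd, and let $a_0,\dots,a_{L-1}$ and $a_0^\dagger,\dots,a_{L-1}^\dagger$ be the annihilation and creation operators of $L$ fermionic modes, acting on the $2^L$-dimensional Fock space with orthonormal Fock basis $|\boldsymbol n\rangle=(a_0^\dagger)^{n_0}\cdots(a_{L-1}^\dagger)^{n_{L-1}}|\boldsymbol 0\rangle$, $\boldsymbol n\in\{0,1\}^L$. All mode indices are understood modulo $L$. Let $CU_{\rm Sym}(L)$ be the compact group of unitary $L\times L$ matrices $u$ with $u_{i,j}=u_{i+k,j+k}$ and $u_{i,j}=u_{j,i}$ for all $i,j,k$. For such $u$ let $U=U(u)$ be the free-fermion unitary on Fock space with $U a_iU^\dagger=\sum_j u_{i,j}a_j$ for all $i$ (unique up to a phase, which does not matter below). The measurement channel is the linear map $$\mathcal M(O)=\sum_{\boldsymbol n\in\{0,1\}^L}\mathbb E_{u}\;\langle\boldsymbol n|U O U^\dagger|\boldsymbol n\rangle\;U^\dagger|\boldsymbol n\rangle\langle\boldsymbol n|U ,$$ where $u$ is distributed according to the Haar probability measure on $CU_{\rm Sym}(L)$. Let $W_2=\mathrm{span}_{\mathbb C}\{a_i^\dagger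 a_j: 0\le i,j\le L-1\}$. Then $$\mathrm{Im}(\mathcal M|_{W_2})=\Big\{\sum_{l,m=0}^{L-1}b_{l,m}\,a_l^\dagger a_m\;\Big|\;b_{l,m}\in\mathbb C,\ \sum_{i=0}^{L-1}b_{i,i+k}=0\ \text{ for all } k\in\{1,\dots,L-1\}\Big\},$$ and a basis of $\mathrm{Im}(\mathcal M|_{W_2})$ is given by the operators $$a_i^\dagger a_j-a_{L-1}^\dagger a_{j-i-1}\quad(0\le i\le L-2,\ 0\le j\le L-1,\ j\neq i)\qquad\text{together with}\qquad a_i^\dagger a_i\quad(0\le i\le L-1).$$ -/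

import Mathlib

open MeasureTheory Matrix

namespace FermionShadow

/-! ### Fermionic Fock space on `L` modes -/

/-- Occupation numbers `(n₀, …, n_{L-1})`; these label the Fock basis `|n⟩`. -/
abbrev Occ (L : ℕ) := Fin L → Bool

/-- Operators on the fermionic Hilbert space `(ℂ²)^{⊗ L}`, written as matrices in the orthonormal
Fock basis; the Hilbert space adjoint is the conjugate transpose. -/
abbrev FockOp (L : ℕ) := Matrix (Occ L) (Occ L) ℂ

/-- The annihilation operator `a_j`. In the Fock basis
`|n⟩ = (a₀†)^{n₀} ⋯ (a_{L-1}†)^{n_{L-1}} |0⟩` it acts by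
`a_j |n⟩ = n_j (-1)^{n₀ + ⋯ + n_{j-1}} |n with n_j replaced by 0⟩`. -/
def annih {L : ℕ} (j : Fin L) : FockOp L :=
  Matrix.of fun m n =>
    if n j = true ∧ m = Function.update n j false then
      (-1 : ℂ) ^ (Finset.univ.filter fun i : Fin L => i < j ∧ n i = true).card
    else 0

/-- The creation operator `a_j†`. -/
def creat {L : ℕ} (j : Fin L) : FockOp L := (annih j)ᴴ

/-- The vacuum occupation numbers. -/
def vac (L : ℕ) : Occ L := fun _ => false

/-- The projector `|n⟩⟨n|` onto a Fock basis vector. -/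
def fockProj {L : ℕ} (n : Occ L) : FockOp L := Matrix.single n n 1

/-- The two-point operator `a_i† a_j`. -/
def twoPoint {L : ℕ} (i j : Fin L) : FockOp L := creat i * annih j

/-- The space `W₂` of two-point operators. -/
def W₂ (L : ℕ) : Submodule ℂ (FockOp L) :=
  Submodule.span ℂ (Set.range fun p : Fin L × Fin L => twoPoint p.1 p.2)

/-! ### Free evolutions -/

/-- The transformed creation operator `∑_j conj(u_{ij}) a_j†`, the adjoint of `∑_j u_{ij} a_j`. -/
def rotCreat {L : ℕ} (u : Matrix (Fin L) (Fin L) ℂ) (i : Fin L) : FockOp L :=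
  ∑ j, star (u i j) • creat j

/-- The free, particle number preserving evolution `U` on Fock space belonging to the mode space
matrix `u`, that is, `U a_i U† = ∑_j u_{ij} a_j`. This fixes `U` up to a phase (which plays no role
in the measurement channel), chosen here such that `U |0⟩ = |0⟩`. Explicitly,
`U |n⟩ = (U a₀† U†)^{n₀} ⋯ (U a_{L-1}† U†)^{n_{L-1}} |0⟩` with `U a_i† U† = ∑_j conj(u_{ij}) a_j†`. -/
def freeEvolution {L : ℕ} (u : Matrix (Fin L) (Fin L) ℂ) : FockOp L :=
  Matrix.of fun m n =>
    (List.ofFn fun i : Fin L => if n i = true then rotCreat u i else 1).prod m (vac L)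

/-! ### The group of symmetric circulant unitaries and its Haar measure -/

/-- `M_{i,j} = M_{i+k,j+k}`, with indices modulo `L`. -/
def IsCirculant {L : ℕ} [NeZero L] (M : Matrix (Fin L) (Fin L) ℂ) : Prop :=
  ∀ i j k : Fin L, M i j = M (i + k) (j + k)

theorem IsCirculant.eq_circulant {L : ℕ} [NeZero L] {M : Matrix (Fin L) (Fin L) ℂ}
    (h : IsCirculant M) : M = Matrix.circulant fun i => M i 0 := by
  ext i j
  have := h (i - j) 0 j
  simpa using this.symm

theorem IsCirculant.mul {L : ℕ} [NeZero L] {M N : Matrix (Fin L) (Fin L) ℂ}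
    (hM : IsCirculant M) (hN : IsCirculant N) : IsCirculant (M * N) := by
  intro i j k
  simp only [Matrix.mul_apply]
  rw [← Equiv.sum_comp (Equiv.addRight k) fun s => M (i + k) s * N s (j + k)]
  refine Finset.sum_congr rfl fun s _ => ?_
  simp only [Equiv.coe_addRight]
  rw [← hM, ← hN]

theorem IsCirculant.mul_comm {L : ℕ} [NeZero L] {M N : Matrix (Fin L) (Fin L) ℂ}
    (hM : IsCirculant M) (hN : IsCirculant N) : M * N = N * M := by
  rw [hM.eq_circulant, hN.eq_circulant, Fin.circulant_mul_comm]

/-- The group `CU_Sym(L)` of symmetric circulant unitary `L × L` matrices. -/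
def CUSym (L : ℕ) [NeZero L] : Subgroup (Matrix.unitaryGroup (Fin L) ℂ) where
  carrier := {u | IsCirculant u.1 ∧ ∀ i j, u.1 i j = u.1 j i}
  one_mem' := by
    constructor
    · intro i j k
      simp [Matrix.one_apply]
    · intro i j
      simp [Matrix.one_apply, eq_comm]
  mul_mem' := by
    rintro u v ⟨hu, hu'⟩ ⟨hv, hv'⟩
    refine ⟨hu.mul hv, fun i j => ?_⟩
    have hut : u.1ᵀ = u.1 := by ext a b; exact hu' b a
    have hvt : v.1ᵀ = v.1 := by ext a b; exact hv' b a
    have h : (u.1 * v.1)ᵀ = u.1 * v.1 := by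
      rw [Matrix.transpose_mul, hut, hvt, hv.mul_comm hu]
    exact (congrFun (congrFun h j) i)
  inv_mem' := by
    rintro u ⟨hu, hu'⟩
    refine ⟨fun i j k => ?_, fun i j => ?_⟩
    · change star (u.1 j i) = star (u.1 (j + k) (i + k))
      rw [← hu]
    · change star (u.1 j i) = star (u.1 i j)
      rw [hu']

instance (L : ℕ) [NeZero L] : CompactSpace (CUSym L) := by
  have hc : IsCompact {M : Matrix (Fin L) (Fin L) ℂ | M ∈ Matrix.unitaryGroup (Fin L) ℂ ∧
      IsCirculant M ∧ ∀ i j, M i j = M j i} := by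
    have hB : IsCompact {M : Fin L → Fin L → ℂ | ∀ i, M i ∈ {v : Fin L → ℂ |
        ∀ j, v j ∈ Metric.closedBall (0 : ℂ) 1}} :=
      isCompact_pi_infinite fun _ => isCompact_pi_infinite fun _ => isCompact_closedBall 0 1
    refine IsCompact.of_isClosed_subset (X := Matrix (Fin L) (Fin L) ℂ) hB ?_ ?_
    · refine IsClosed.inter ?_ (IsClosed.inter ?_ ?_)
      · have : {M : Matrix (Fin L) (Fin L) ℂ | M ∈ Matrix.unitaryGroup (Fin L) ℂ} =
            {M | M * Mᴴ = 1} := by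
          ext M; exact Matrix.mem_unitaryGroup_iff
        change IsClosed {M : Matrix (Fin L) (Fin L) ℂ | M ∈ Matrix.unitaryGroup (Fin L) ℂ}
        rw [this]
        exact isClosed_eq (by fun_prop) continuous_const
      · change IsClosed {M : Matrix (Fin L) (Fin L) ℂ | ∀ i j k, M i j = M (i + k) (j + k)}
        simp only [Set.ofPred_forall]
        exact isClosed_iInter fun i => isClosed_iInter fun j => isClosed_iInter fun k =>
          isClosed_eq (by fun_prop) (by fun_prop)
      · change IsClosed {M : Matrix (Fin L) (Fin L) ℂ | ∀ i j, M i j = M j i}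
        simp only [Set.ofPred_forall]
        exact isClosed_iInter fun i => isClosed_iInter fun j =>
          isClosed_eq (by fun_prop) (by fun_prop)
    · rintro M ⟨hM, -⟩ i j
      simpa using entry_norm_bound_of_unitary hM i j
  rw [← isCompact_univ_iff, Subtype.isCompact_iff, Subtype.isCompact_iff]
  convert hc using 1
  ext M
  constructor
  · rintro ⟨v, ⟨w, -, rfl⟩, rfl⟩
    exact ⟨w.1.2, w.2⟩
  · rintro ⟨h1, h2⟩
    exact ⟨⟨M, h1⟩, ⟨⟨⟨M, h1⟩, h2⟩, trivial, rfl⟩, rfl⟩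

noncomputable instance (L : ℕ) [NeZero L] : MeasurableSpace (CUSym L) := borel _

instance (L : ℕ) [NeZero L] : BorelSpace (CUSym L) := ⟨rfl⟩

/-- The Haar measure on `CU_Sym(L)`, normalized to total mass one. -/
noncomputable def haarCUSym (L : ℕ) [NeZero L] : Measure (CUSym L) :=
  Measure.haarMeasure ⊤

instance (L : ℕ) [NeZero L] : IsProbabilityMeasure (haarCUSym L) :=
  ⟨by simpa [haarCUSym] using Measure.haarMeasure_self (G := CUSym L) (K₀ := ⊤)⟩

/-! ### The measurement channel -/

/-- One sampled term of the measurement channel,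
`⟨n| U O U† |n⟩ U† |n⟩⟨n| U` with `U` the evolution belonging to `u`. -/
noncomputable def channelTerm {L : ℕ} (u : Matrix (Fin L) (Fin L) ℂ) (n : Occ L) (O : FockOp L) : FockOp L :=
  (freeEvolution u * O * (freeEvolution u)ᴴ) n n •
    ((freeEvolution u)ᴴ * fockProj n * freeEvolution u)

theorem continuous_freeEvolution (L : ℕ) :
    Continuous (freeEvolution : Matrix (Fin L) (Fin L) ℂ → FockOp L) := by
  refine continuous_matrix fun m n => ?_
  have : Continuous fun u : Matrix (Fin L) (Fin L) ℂ =>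
      (List.ofFn fun i : Fin L => if n i = true then rotCreat u i else 1).prod := by
    simp only [List.ofFn_eq_map]
    refine continuous_list_prod _ fun i _ => ?_
    by_cases h : n i = true
    · simp only [h, if_true, rotCreat]
      fun_prop
    · simp only [h]
      exact continuous_const
  exact this.matrix_elem m (vac L)

theorem integrable_channelTerm {L : ℕ} [NeZero L] (n : Occ L) (O : FockOp L) (r s : Occ L) :
    Integrable (fun u : CUSym L => channelTerm u.1.1 n O r s) (haarCUSym L) := by
  have h1 : Continuous fun u : CUSym L => freeEvolution u.1.1 :=
    (continuous_freeEvolution L).comp (continuous_subtype_val.comp continuous_subtype_val)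
  have h2 : Continuous fun u : CUSym L => channelTerm u.1.1 n O r s := by
    unfold channelTerm
    fun_prop
  have h3 := h2.continuousOn.integrableOn_compact (μ := haarCUSym L) isCompact_univ
  simpa using h3

/-- The measurement channel
`𝓜(O) = ∑_n 𝔼_u ⟨n| U O U† |n⟩ U† |n⟩⟨n| U`, with the mode space unitary `u` of `U` drawn from the
Haar measure on `CU_Sym(L)`; the operator-valued expectation is taken entrywise. -/
noncomputable def measurementChannel (L : ℕ) [NeZero L] : FockOp L →ₗ[ℂ] FockOp L where
  toFun O := Matrix.of fun r s =>
    ∑ n : Occ L, ∫ u : CUSym L, channelTerm u.1.1 n O r s ∂(haarCUSym L)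
  map_add' O P := by
    ext r s
    simp only [Matrix.of_apply, Matrix.add_apply]
    rw [← Finset.sum_add_distrib]
    refine Finset.sum_congr rfl fun n _ => ?_
    rw [← integral_add (integrable_channelTerm n O r s) (integrable_channelTerm n P r s)]
    refine integral_congr_ae (Filter.Eventually.of_forall fun u => ?_)
    simp only [channelTerm, Matrix.mul_add, Matrix.add_mul, Matrix.add_apply, Matrix.smul_apply,
      smul_eq_mul]
    ring
  map_smul' c O := by
    ext r s
    simp only [Matrix.of_apply, Matrix.smul_apply, RingHom.id_apply, smul_eq_mul]
    rw [Finset.mul_sum]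
    refine Finset.sum_congr rfl fun n _ => ?_
    rw [← integral_const_mul]
    refine integral_congr_ae (Filter.Eventually.of_forall fun u => ?_)
    simp only [channelTerm, Matrix.mul_smul, Matrix.smul_mul, Matrix.smul_apply, smul_eq_mul]
    ring

/-- The image of the restriction of the measurement channel to the two-point operators. -/
noncomputable def imageTwoPoint (L : ℕ) [NeZero L] : Submodule ℂ (FockOp L) :=
  LinearMap.range ((measurementChannel L).domRestrict (W₂ L))

/-! ### The proposed basis -/

/-- The last mode `L - 1`. -/
def lastMode (L : ℕ) [NeZero L] : Fin L := ⟨L - 1, Nat.sub_lt (NeZero.pos L) Nat.one_pos⟩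

/-- Labels of the basis: pairs `(i, j)` with `i ∈ {0, …, L-2}`, `j ∈ {0, …, L-1}`, `j ≠ i`, and in
addition the modes `i ∈ {0, …, L-1}`. -/
abbrev BasisIndex (L : ℕ) [NeZero L] :=
  {p : Fin L × Fin L // p.1 ≠ lastMode L ∧ p.2 ≠ p.1} ⊕ Fin L

/-- The operators `a_i† a_j - a_{L-1}† a_{j-i-1}` (indices modulo `L`) and `a_i† a_i`. -/
def basisOp {L : ℕ} [NeZero L] : BasisIndex L → FockOp L
  | Sum.inl p => twoPoint p.1.1 p.1.2 - twoPoint (lastMode L) (p.1.2 - p.1.1 - 1)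
  | Sum.inr i => twoPoint i i

end FermionShadow

/-! Write `secondQuant L b` for the sum of b_{lm} a_l† a_m. Conjugation by U turns b into uᴴbu, and
keeping only the Fock diagonal of a two-point operator keeps the diagonal of its coefficient matrix.
Hence 𝓜 acts on W₂ through `coeffChannel`, the Haar average of b ↦ u diag(uᴴbu) uᴴ
(`measurementChannel_secondQuant`).

The columns of a circulant unitary are shifts of each other and orthogonal, so the image of every
single `dephase u` already lies in V = `zeroDiagonalSums L`. Conversely `coeffChannel` maps V to
itself, and in finite dimension surjectivity onto V follows from injectivity on V. If `coeffChannel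
L b = 0`, pairing with b gives ∫ ∑_p |(uᴴbu)_{pp}|² = 0, so all these diagonal entries vanish for
every u in the group.

Now let u have DFT eigenvalues `evenPhase w`, with w arbitrary. Then (uᴴbu)_{pp} is a combination of
characters of (w, p) whose coefficients are the Fourier coefficients of b. For L odd the characters
of off-diagonal pairs are distinct and nontrivial (`pairCharacter_injective`), so independence of
characters kills the off-diagonal coefficients and the sum of the diagonal ones. On V the diagonal
ones are all equal to tr b, hence zero, and b = 0.

The basis is read off from matrix elements between one-particle states, which recover b: each basis
operator has one leading entry that no other basis operator has (`dualBases_basisOp`). -/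

namespace FermionShadow

/-! ### Canonical anticommutation relations -/

/-- The Jordan-Wigner sign `(-1)^{n₀ + ⋯ + n_{j-1}}`. -/
def jwSign {L : ℕ} (j : Fin L) (n : Occ L) : ℂ := ∏ i ∈ Finset.Iio j, if n i = true then -1 else 1

theorem neg_one_pow_card_eq_jwSign {L : ℕ} (j : Fin L) (n : Occ L) :
    (-1 : ℂ) ^ (Finset.univ.filter fun i : Fin L => i < j ∧ n i = true).card = jwSign j n := by
  rw [jwSign, Finset.prod_ite, Finset.prod_const, Finset.prod_const_one, mul_one]
  congr 2
  ext i
  simp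

theorem jwSign_ne_zero {L : ℕ} (j : Fin L) (n : Occ L) : jwSign j n ≠ 0 := by
  rw [← neg_one_pow_card_eq_jwSign]
  exact pow_ne_zero _ (by norm_num)

theorem jwSign_mul_self {L : ℕ} (j : Fin L) (n : Occ L) : jwSign j n * jwSign j n = 1 := by
  rw [← neg_one_pow_card_eq_jwSign, ← mul_pow]
  norm_num

theorem star_jwSign {L : ℕ} (j : Fin L) (n : Occ L) : star (jwSign j n) = jwSign j n := by
  rw [← neg_one_pow_card_eq_jwSign]
  simp

theorem jwSign_update_of_le {L : ℕ} {i j : Fin L} (h : j ≤ i) (n : Occ L) (b : Bool) :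
    jwSign j (Function.update n i b) = jwSign j n := by
  refine Finset.prod_congr rfl fun k hk => ?_
  rw [Function.update_of_ne ((Finset.mem_Iio.1 hk).trans_le h).ne]

theorem jwSign_update_of_lt {L : ℕ} {i j : Fin L} (h : i < j) (n : Occ L) {b : Bool}
    (hb : n i ≠ b) : jwSign j (Function.update n i b) = -jwSign j n := by
  have hi : i ∈ Finset.Iio j := Finset.mem_Iio.2 h
  rw [jwSign, jwSign, ← Finset.mul_prod_erase _ _ hi, ← Finset.mul_prod_erase _ _ hi, ← neg_mul]
  congr 1
  · cases b <;> cases hn : n i <;> simp_all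
  · refine Finset.prod_congr rfl fun k hk => ?_
    rw [Function.update_of_ne (Finset.ne_of_mem_erase hk)]

theorem mul_annih_apply {L : ℕ} (X : FockOp L) (j : Fin L) (r n : Occ L) :
    (X * annih j) r n =
      if n j = true then jwSign j n * X r (Function.update n j false) else 0 := by
  simp only [mul_apply, annih, of_apply, neg_one_pow_card_eq_jwSign]
  split_ifs with h
  · simp [h, mul_comm]
  · simp [h]

theorem mul_creat_apply {L : ℕ} (X : FockOp L) (j : Fin L) (r n : Occ L) :
    (X * creat j) r n =
      if n j = false then jwSign j n * X r (Function.update n j true) else 0 := by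
  simp only [mul_apply, creat, conjTranspose_apply, annih, of_apply, neg_one_pow_card_eq_jwSign]
  split_ifs with h
  · rw [Finset.sum_eq_single (Function.update n j true)]
    · simp [star_jwSign, jwSign_update_of_le le_rfl, ← h, mul_comm]
    · intro m _ hm
      rw [if_neg, star_zero, mul_zero]
      rintro ⟨h1, rfl⟩
      apply hm
      simp [← h1]
    · simp
  · refine Finset.sum_eq_zero fun m _ => ?_
    rw [if_neg, star_zero, mul_zero]
    rintro ⟨h1, rfl⟩
    simp at h

theorem annih_mul_annih {L : ℕ} (i j : Fin L) :
    (annih i * annih j : FockOp L) = -(annih j * annih i) := by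
  rcases eq_or_ne i j with rfl | hij
  · have : (annih i * annih i : FockOp L) = 0 := by
      ext r n
      rw [← Matrix.one_mul (annih i * annih i), ← Matrix.mul_assoc, mul_annih_apply,
        mul_annih_apply]
      simp
    simp [this]
  wlog h : i < j generalizing i j
  · rw [this j i hij.symm (lt_of_le_of_ne (not_lt.1 h) hij.symm), neg_neg]
  rw [← Matrix.one_mul (annih i), ← Matrix.one_mul (annih j)]
  ext r n
  simp only [Matrix.one_mul, Matrix.neg_apply]
  rw [mul_annih_apply, mul_annih_apply, ← Matrix.one_mul (annih i), ← Matrix.one_mul (annih j),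
    mul_annih_apply, mul_annih_apply, Function.update_of_ne hij, Function.update_of_ne hij.symm,
    jwSign_update_of_le h.le]
  by_cases h1 : n i = true <;> by_cases h2 : n j = true <;> simp only [h1, h2, if_true]
  -- Only the sign of the later mode `j` sees the occupation of `i`, so exactly one of the two
  -- orders picks up a minus sign.
  · rw [jwSign_update_of_lt h n (by simp [h1]), Function.update_comm hij]
    ring
  all_goals simp

theorem creat_mul_creat {L : ℕ} (i j : Fin L) :
    (creat i * creat j : FockOp L) = -(creat j * creat i) := by
  simp only [creat, ← conjTranspose_mul, ← conjTranspose_neg, ← annih_mul_annih]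

theorem annih_mul_creat {L : ℕ} (i j : Fin L) :
    (annih i * creat j : FockOp L) = (if i = j then 1 else 0) - creat j * annih i := by
  rw [eq_sub_iff_add_eq]
  -- The spare factor 1 lets the column formulas for right multiplication be applied twice.
  suffices 1 * annih i * creat j + 1 * creat j * annih i = (if i = j then 1 else 0 : FockOp L) by
    simpa only [Matrix.one_mul] using this
  ext r n
  rw [Matrix.add_apply, mul_creat_apply, mul_annih_apply, mul_annih_apply, mul_creat_apply]
  rcases eq_or_ne i j with rfl | hij
  · rw [jwSign_update_of_le le_rfl, jwSign_update_of_le le_rfl]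
    cases h : n i
    · have : Function.update (Function.update n i true) i false = n := by
        rw [Function.update_idem, ← h, Function.update_eq_self]
      simp only [Function.update_self, if_true, if_false, reduceCtorEq, ← mul_assoc,
        jwSign_mul_self, one_mul, add_zero]
      rw [this]
    · have : Function.update (Function.update n i false) i true = n := by
        rw [Function.update_idem, ← h, Function.update_eq_self]
      simp only [Function.update_self, if_true, if_false, reduceCtorEq, ← mul_assoc,
        jwSign_mul_self, one_mul, zero_add]
      rw [this]
  · rw [Function.update_of_ne hij, Function.update_of_ne hij.symm, if_neg hij]
    cases h1 : n i <;> cases h2 : n j <;> simp only [if_true, if_false, Matrix.zero_apply,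
      reduceCtorEq, mul_zero, add_zero]
    rw [Function.update_comm hij]
    rcases hij.lt_or_gt with h | h
    · rw [jwSign_update_of_le h.le, jwSign_update_of_lt h n (by simp [h1])]
      ring
    · rw [jwSign_update_of_le h.le, jwSign_update_of_lt h n (by simp [h2])]
      ring

theorem rotCreat_mul_rotCreat {L : ℕ} (u : Matrix (Fin L) (Fin L) ℂ) (i j : Fin L) :
    rotCreat u i * rotCreat u j = -(rotCreat u j * rotCreat u i) := by
  simp only [rotCreat, Finset.sum_mul, Finset.mul_sum, ← Finset.sum_neg_distrib]
  rw [Finset.sum_comm]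
  refine Finset.sum_congr rfl fun k _ => Finset.sum_congr rfl fun l _ => ?_
  rw [Matrix.smul_mul, Matrix.smul_mul, Matrix.mul_smul, Matrix.mul_smul, creat_mul_creat,
    smul_neg, smul_neg, smul_comm]

theorem conjTranspose_rotCreat {L : ℕ} (u : Matrix (Fin L) (Fin L) ℂ) (i : Fin L) :
    (rotCreat u i)ᴴ = ∑ j, u i j • annih j := by
  simp [rotCreat, conjTranspose_sum, creat]

theorem conjTranspose_rotCreat_mul_rotCreat {L : ℕ} {u : Matrix (Fin L) (Fin L) ℂ}
    (hu : u ∈ Matrix.unitaryGroup (Fin L) ℂ) (i j : Fin L) :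
    (rotCreat u i)ᴴ * rotCreat u j = (if i = j then 1 else 0) - rotCreat u j * (rotCreat u i)ᴴ := by
  have h : ∑ k, u i k * star (u j k) = if i = j then 1 else 0 := by
    simpa [mul_apply, star_apply, Matrix.one_apply] using
      congrFun (congrFun (Matrix.mem_unitaryGroup_iff.1 hu) i) j
  have h' : (if i = j then 1 else 0 : FockOp L) = ∑ k, (u i k * star (u j k)) • (1 : FockOp L) := by
    rw [← Finset.sum_smul, h]
    split_ifs <;> simp
  rw [h', conjTranspose_rotCreat, rotCreat]
  simp only [Finset.sum_mul_sum, Matrix.smul_mul, Matrix.mul_smul, smul_smul]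
  rw [Finset.sum_comm (f := fun k l => (u i l * star (u j k)) • (creat k * annih l)),
    ← Finset.sum_sub_distrib]
  refine Finset.sum_congr rfl fun k _ => ?_
  simp only [annih_mul_creat, smul_sub, Finset.sum_sub_distrib]
  simp [mul_comm]

theorem creat_eq_sum_rotCreat {L : ℕ} {u : Matrix (Fin L) (Fin L) ℂ}
    (hu : u ∈ Matrix.unitaryGroup (Fin L) ℂ) (p : Fin L) :
    creat p = ∑ i, u i p • rotCreat u i := by
  have h (j : Fin L) : ∑ k, u k p * star (u k j) = if j = p then 1 else 0 := by
    simpa [mul_apply, star_apply, Matrix.one_apply, mul_comm] using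
      congrFun (congrFun (Matrix.mem_unitaryGroup_iff'.1 hu) j) p
  simp only [rotCreat, Finset.smul_sum, smul_smul]
  rw [Finset.sum_comm]
  simp only [← Finset.sum_smul, h]
  simp

/-! ### Free evolutions are unitary and intertwine the two sets of modes -/

theorem Occ.induction {L : ℕ} {P : Occ L → Prop} (hvac : P (vac L))
    (hupd : ∀ n j, n j = false → P n → P (Function.update n j true)) (n : Occ L) : P n := by
  classical
  have key (S : Finset (Fin L)) : P fun i => decide (i ∈ S) := by
    induction S using Finset.induction_on with
    | empty => exact hvac
    | insert j S hj ih =>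
      convert hupd _ j (by simpa using hj) ih using 1
      ext i
      by_cases h : i = j
      · subst h; simp
      · simp [h]
  convert key (Finset.univ.filter fun i => n i = true) using 1
  ext i
  simp

/-- Up to sign, the column of `X` at `n` with `j` filled is `Y j` applied to the column at `n`, so
vanishing spreads from the vacuum to all columns. This is the uniqueness principle behind both the
intertwining relation for `annih` and the unitarity of U. -/
theorem eq_zero_of_mul_creat {L : ℕ} {X : FockOp L} {Y : Fin L → FockOp L}
    (hvac : ∀ r, X r (vac L) = 0) (h : ∀ j, X * creat j = Y j * X) : X = 0 := by
  suffices ∀ n r, X r n = 0 by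
    ext r n
    exact this n r
  refine Occ.induction hvac fun n j hn ih r => ?_
  have := congrFun (congrFun (h j) r) n
  rw [mul_creat_apply, if_pos hn, mul_apply] at this
  simpa [ih, jwSign_ne_zero] using this

theorem mul_list_prod_eq_sign_smul {L : ℕ} (c : Fin L → FockOp L) (x : FockOp L)
    (h : ∀ i, x * c i = -(c i * x)) (n : Occ L) (l : List (Fin L)) :
    x * (l.map fun i => if n i = true then c i else 1).prod =
      (l.map fun i => if n i = true then (-1 : ℂ) else 1).prod •
        ((l.map fun i => if n i = true then c i else 1).prod * x) := by
  induction l with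
  | nil => simp
  | cons i l ih =>
    simp only [List.map_cons, List.prod_cons]
    split_ifs
    · rw [← Matrix.mul_assoc, h, Matrix.neg_mul, Matrix.mul_assoc, ih, Matrix.mul_smul,
        Matrix.mul_assoc]
      simp
    · simp [ih]

/-- Anticommuting past the occupied modes before `j` produces the Jordan-Wigner sign; at slot `j`
the operator either fills it or meets itself and squares to zero. -/
theorem rotCreat_mul_prod {L : ℕ} (u : Matrix (Fin L) (Fin L) ℂ) (j : Fin L) (n : Occ L) :
    rotCreat u j * (List.ofFn fun i : Fin L => if n i = true then rotCreat u i else 1).prod =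
      if n j = false then jwSign j n • (List.ofFn fun i : Fin L =>
        if Function.update n j true i = true then rotCreat u i else 1).prod else 0 := by
  obtain ⟨l₁, l₂, hl⟩ := List.append_of_mem (List.mem_finRange j)
  have hs : (l₁ ++ j :: l₂).Pairwise (· < ·) := hl ▸ List.pairwise_lt_finRange L
  rw [List.pairwise_append, List.pairwise_cons] at hs
  obtain ⟨hs₁, ⟨hs₂, -⟩, hs₃⟩ := hs
  have hl₁ : l₁.toFinset = Finset.Iio j := by
    ext i
    rw [List.mem_toFinset, Finset.mem_Iio]
    refine ⟨fun hi => hs₃ i hi j (by simp), fun hi => ?_⟩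
    have : i ∈ l₁ ++ j :: l₂ := hl ▸ List.mem_finRange i
    rcases List.mem_append.1 this with h | h
    · exact h
    · rcases List.mem_cons.1 h with rfl | h
      · exact absurd hi (lt_irrefl _)
      · exact absurd hi (hs₂ i h).not_gt
  have hsign : (l₁.map fun i => if n i = true then (-1 : ℂ) else 1).prod = jwSign j n := by
    rw [jwSign, ← hl₁, List.prod_toFinset _ (hs₁.imp fun h => h.ne)]
  have hu₁ : (l₁.map fun i => if Function.update n j true i = true then rotCreat u i else 1) =
      l₁.map fun i => if n i = true then rotCreat u i else 1 := by
    refine List.map_congr_left fun i hi => ?_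
    rw [Function.update_of_ne (hs₃ i hi j (by simp)).ne]
  have hu₂ : (l₂.map fun i => if Function.update n j true i = true then rotCreat u i else 1) =
      l₂.map fun i => if n i = true then rotCreat u i else 1 := by
    refine List.map_congr_left fun i hi => ?_
    rw [Function.update_of_ne (hs₂ i hi).ne']
  have hsq : rotCreat u j * rotCreat u j = 0 := by
    ext r s
    exact self_eq_neg.1 (congrFun (congrFun (rotCreat_mul_rotCreat u j j) r) s)
  rw [List.ofFn_eq_map, List.ofFn_eq_map, hl, List.map_append, List.map_append, List.prod_append,
    List.prod_append, ← Matrix.mul_assoc,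
    mul_list_prod_eq_sign_smul _ _ (rotCreat_mul_rotCreat u j), hsign, hu₁, List.map_cons,
    List.map_cons, List.prod_cons, List.prod_cons, hu₂, Matrix.smul_mul, Matrix.mul_assoc]
  cases h : n j
  · simp
  · simp [← Matrix.mul_assoc, hsq]

theorem mul_freeEvolution_apply {L : ℕ} (X : FockOp L) (u : Matrix (Fin L) (Fin L) ℂ)
    (m n : Occ L) : (X * freeEvolution u) m n =
      (X * (List.ofFn fun i : Fin L => if n i = true then rotCreat u i else 1).prod) m (vac L) := by
  simp [mul_apply, freeEvolution]

theorem mul_freeEvolution_vac {L : ℕ} (X : FockOp L) (u : Matrix (Fin L) (Fin L) ℂ)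
    (m : Occ L) : (X * freeEvolution u) m (vac L) = X m (vac L) := by
  rw [mul_freeEvolution_apply]
  simp [vac, List.ofFn_const]

theorem freeEvolution_mul_creat {L : ℕ} (u : Matrix (Fin L) (Fin L) ℂ) (j : Fin L) :
    freeEvolution u * creat j = rotCreat u j * freeEvolution u := by
  ext m n
  rw [mul_creat_apply, mul_freeEvolution_apply, rotCreat_mul_prod]
  split_ifs
  · rfl
  · rfl

theorem freeEvolution_mul_annih {L : ℕ} {u : Matrix (Fin L) (Fin L) ℂ}
    (hu : u ∈ Matrix.unitaryGroup (Fin L) ℂ) (i : Fin L) :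
    freeEvolution u * annih i = (rotCreat u i)ᴴ * freeEvolution u := by
  rw [← sub_eq_zero]
  -- Both sides obey the same anticommutation rule with `creat j`, the scalar terms cancelling in
  -- the difference; both annihilate the vacuum.
  refine eq_zero_of_mul_creat (Y := fun j => -rotCreat u j) (fun r => ?_) fun j => ?_
  · rw [Matrix.sub_apply, mul_annih_apply, mul_freeEvolution_vac, conjTranspose_rotCreat,
      Matrix.sum_apply]
    simp [vac, annih]
  · rw [Matrix.sub_mul, Matrix.mul_assoc, annih_mul_creat, Matrix.mul_assoc,
      freeEvolution_mul_creat, ← Matrix.mul_assoc, conjTranspose_rotCreat_mul_rotCreat hu,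
      Matrix.mul_sub, ← Matrix.mul_assoc, freeEvolution_mul_creat]
    split_ifs <;> noncomm_ring

theorem freeEvolution_vac_apply {L : ℕ} (u : Matrix (Fin L) (Fin L) ℂ) (n : Occ L) :
    freeEvolution u (vac L) n = if n = vac L then 1 else 0 := by
  refine Occ.induction (P := fun n => freeEvolution u (vac L) n = if n = vac L then 1 else 0)
    ?_ (fun n j hn _ => ?_) n
  · simpa using mul_freeEvolution_vac 1 u (vac L)
  · have h := congrFun (congrFun (freeEvolution_mul_creat u j) (vac L)) n
    rw [mul_creat_apply, if_pos hn, mul_apply] at h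
    have h0 (k : Occ L) : rotCreat u j (vac L) k = 0 := by
      rw [rotCreat, Matrix.sum_apply]
      simp [creat, annih, vac]
    simp only [h0, zero_mul, Finset.sum_const_zero, mul_eq_zero, jwSign_ne_zero, false_or] at h
    rw [h, if_neg]
    intro h'
    simpa [vac] using congrFun h' j

theorem freeEvolution_mul_conjTranspose {L : ℕ} {u : Matrix (Fin L) (Fin L) ℂ}
    (hu : u ∈ Matrix.unitaryGroup (Fin L) ℂ) : freeEvolution u * (freeEvolution u)ᴴ = 1 := by
  have h1 (j : Fin L) : (freeEvolution u)ᴴ * rotCreat u j = creat j * (freeEvolution u)ᴴ := by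
    have := congrArg conjTranspose (freeEvolution_mul_annih hu j)
    rw [conjTranspose_mul, conjTranspose_mul, conjTranspose_conjTranspose] at this
    exact this.symm
  rw [← sub_eq_zero]
  -- UU† commutes with each `rotCreat u j`, hence with every `creat p`, and it fixes the vacuum.
  refine eq_zero_of_mul_creat (Y := creat) (fun r => ?_) fun p => ?_
  · have : (1 : FockOp L) r (vac L) = freeEvolution u r (vac L) := by
      simpa using (mul_freeEvolution_vac 1 u r).symm
    rw [Matrix.sub_apply, this, mul_apply]
    simp [conjTranspose_apply, freeEvolution_vac_apply]
  · rw [creat_eq_sum_rotCreat hu, Matrix.mul_sum, Matrix.sum_mul]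
    refine Finset.sum_congr rfl fun j _ => ?_
    rw [Matrix.mul_smul, Matrix.smul_mul, Matrix.sub_mul, Matrix.mul_sub, Matrix.mul_assoc, h1,
      ← Matrix.mul_assoc, freeEvolution_mul_creat, Matrix.mul_assoc, Matrix.mul_one, Matrix.one_mul]

/-! ### Discrete Fourier transform on `ℤ/L` -/

/-- The matrix `exp (2πi k x / L)` of the discrete Fourier transform. -/
noncomputable def dft (L : ℕ) : Matrix (Fin L) (Fin L) ℂ :=
  Matrix.of fun x k => Complex.exp (2 * Real.pi * Complex.I / L) ^ (x.val * k.val)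

theorem dft_symm {L : ℕ} (x k : Fin L) : dft L x k = dft L k x := by
  simp [dft, mul_comm]

theorem isPrimitiveRoot_exp (L : ℕ) [NeZero L] :
    IsPrimitiveRoot (Complex.exp (2 * Real.pi * Complex.I / L)) L :=
  Complex.isPrimitiveRoot_exp L (NeZero.ne L)

theorem dft_add {L : ℕ} [NeZero L] (x y k : Fin L) :
    dft L (x + y) k = dft L x k * dft L y k := by
  simp only [dft, of_apply, ← pow_add, ← add_mul, Fin.val_add]
  have h := (isPrimitiveRoot_exp L).pow_eq_one
  rw [pow_mul, pow_mul, pow_eq_pow_mod (x.val + y.val) h]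

theorem dft_zero {L : ℕ} [NeZero L] (k : Fin L) : dft L 0 k = 1 := by
  simp [dft]

theorem star_dft {L : ℕ} [NeZero L] (x k : Fin L) : star (dft L x k) = dft L (-x) k := by
  have h1 : dft L (-x) k * dft L x k = 1 := by rw [← dft_add, neg_add_cancel, dft_zero]
  have h2 : ‖dft L x k‖ = 1 := by
    rw [dft, of_apply, norm_pow, (isPrimitiveRoot_exp L).norm'_eq_one (NeZero.ne L), one_pow]
  rw [eq_inv_of_mul_eq_one_left h1, Complex.inv_eq_conj h2]
  rfl

theorem dft_injective {L : ℕ} [NeZero L] {x y : Fin L} (h : ∀ k, dft L x k = dft L y k) :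
    x = y := by
  rcases (NeZero.one_le (n := L)).eq_or_lt with h1 | h1
  · subst h1
    exact Subsingleton.elim _ _
  · have := h ⟨1, h1⟩
    simp only [dft, of_apply, mul_one] at this
    exact Fin.ext ((isPrimitiveRoot_exp L).pow_inj x.2 y.2 this)

theorem sum_dft {L : ℕ} [NeZero L] (x : Fin L) :
    ∑ k, dft L x k = if x = 0 then (L : ℂ) else 0 := by
  split_ifs with h
  · simp [h, dft_zero]
  · obtain ⟨k, hk⟩ : ∃ k, dft L x k ≠ 1 := by
      by_contra! hc
      exact h (dft_injective fun k => by rw [hc, dft_zero])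
    have : ∑ l, dft L x l = dft L x k * ∑ l, dft L x l := by
      -- Shifting the summation index multiplies the sum by a factor different from 1.
      conv_lhs => rw [← Equiv.sum_comp (Equiv.addLeft k)]
      rw [Finset.mul_sum]
      refine Finset.sum_congr rfl fun l _ => ?_
      rw [Equiv.coe_addLeft, dft_symm, dft_add, dft_symm, dft_symm l]
    have h2 : (dft L x k - 1) * ∑ l, dft L x l = 0 := by rw [sub_mul, ← this, one_mul, sub_self]
    exact (mul_eq_zero.1 h2).resolve_left (sub_ne_zero.2 hk)

theorem dft_mul_conjTranspose (L : ℕ) [NeZero L] : dft L * (dft L)ᴴ = (L : ℂ) • 1 := by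
  ext x y
  simp only [mul_apply, conjTranspose_apply, star_dft, ← dft_add, sum_dft, Matrix.smul_apply,
    Matrix.one_apply, ← sub_eq_add_neg, sub_eq_zero]
  split_ifs <;> simp

theorem dft_transpose (L : ℕ) : (dft L)ᵀ = dft L := by
  ext x y
  exact dft_symm y x

theorem conjTranspose_mul_dft (L : ℕ) [NeZero L] : (dft L)ᴴ * dft L = (L : ℂ) • 1 := by
  have h := congrArg transpose (dft_mul_conjTranspose L)
  rw [transpose_mul, dft_transpose, transpose_smul, transpose_one] at h
  rw [← h]
  congr 1
  ext x y
  simp [conjTranspose_apply, dft_symm]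

/-! ### Symmetric circulant unitaries from phases -/

/-- A reflection-symmetric family of phases on `ℤ/L`. -/
noncomputable def evenPhase {L : ℕ} [NeZero L] (w : Fin L → Circle) (k : Fin L) : Circle := w k * w (-k)

theorem evenPhase_neg {L : ℕ} [NeZero L] (w : Fin L → Circle) (k : Fin L) :
    evenPhase w (-k) = evenPhase w k := by
  rw [evenPhase, evenPhase, neg_neg, mul_comm]

/-- The circulant matrix whose eigenvalues are `evenPhase w`. -/
noncomputable def phaseCirculant {L : ℕ} [NeZero L] (w : Fin L → Circle) :
    Matrix (Fin L) (Fin L) ℂ :=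
  (L : ℂ)⁻¹ • (dft L * diagonal (fun k => (evenPhase w k : ℂ)) * (dft L)ᴴ)

theorem phaseCirculant_apply {L : ℕ} [NeZero L] (w : Fin L → Circle) (x y : Fin L) :
    phaseCirculant w x y = (L : ℂ)⁻¹ * ∑ k, (evenPhase w k : ℂ) * dft L (x - y) k := by
  rw [phaseCirculant, Matrix.smul_apply, mul_apply, smul_eq_mul]
  congr 1
  refine Finset.sum_congr rfl fun k _ => ?_
  rw [mul_diagonal, conjTranspose_apply, star_dft, sub_eq_add_neg, dft_add]
  ring

theorem phaseCirculant_mem_unitaryGroup {L : ℕ} [NeZero L] (w : Fin L → Circle) :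
    phaseCirculant w ∈ Matrix.unitaryGroup (Fin L) ℂ := by
  have hL : (L : ℂ) ≠ 0 := NeZero.ne _
  have hd : diagonal (fun k => (evenPhase w k : ℂ)) *
      (diagonal fun k => (evenPhase w k : ℂ))ᴴ = 1 := by
    rw [diagonal_conjTranspose, diagonal_mul_diagonal, ← diagonal_one]
    congr 1
    ext k
    simp [Complex.mul_conj, Circle.normSq_coe]
  rw [mem_unitaryGroup_iff, star_eq_conjTranspose, phaseCirculant]
  rw [conjTranspose_smul, conjTranspose_mul, conjTranspose_mul, conjTranspose_conjTranspose,
    Matrix.smul_mul, Matrix.mul_smul]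
  have : dft L * diagonal (fun k => (evenPhase w k : ℂ)) * (dft L)ᴴ *
      (dft L * ((diagonal fun k => (evenPhase w k : ℂ))ᴴ * (dft L)ᴴ)) =
      dft L * (diagonal (fun k => (evenPhase w k : ℂ)) * ((dft L)ᴴ * dft L) *
        (diagonal fun k => (evenPhase w k : ℂ))ᴴ) * (dft L)ᴴ := by
    simp only [Matrix.mul_assoc]
  rw [this, conjTranspose_mul_dft, Matrix.mul_smul, Matrix.mul_one, Matrix.smul_mul, hd,
    Matrix.mul_smul, Matrix.mul_one, Matrix.smul_mul, dft_mul_conjTranspose]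
  simp [smul_smul, hL]

/-- The element of `CU_Sym(L)` with prescribed phases. -/
noncomputable def phaseCUSym {L : ℕ} [NeZero L] (w : Fin L → Circle) : CUSym L :=
  ⟨⟨phaseCirculant w, phaseCirculant_mem_unitaryGroup w⟩, by
    constructor
    · intro i j k
      simp only [phaseCirculant_apply, add_sub_add_right_eq_sub]
    · intro i j
      simp only [phaseCirculant_apply]
      rw [← Equiv.sum_comp (Equiv.neg _)]
      refine congrArg _ (Finset.sum_congr rfl fun k _ => ?_)
      rw [Equiv.neg_apply, evenPhase_neg, dft_symm, ← star_dft, dft_symm, star_dft, neg_sub]⟩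

/-! ### Detecting Fourier coefficients by characters -/

/-- Test with phases supported on the orbit {a, -a}: the left side is nontrivial, so `c` or `d` must
meet that orbit. -/
theorem evenPhase_eq_of_mul_eq {L : ℕ} [NeZero L] {a b c d : Fin L}
    (h : ∀ w : Fin L → Circle,
      evenPhase w a * evenPhase w b = evenPhase w c * evenPhase w d) :
    (c = a ∨ c = -a) ∨ (d = a ∨ d = -a) := by
  classical
  by_contra hc
  obtain ⟨h1, h2⟩ := not_or.1 hc
  -- The left side will be r⁴ or r², according to whether `b` lies in the orbit of `a`; r⁴ ≠ 1
  -- excludes both being 1.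
  have hr : ∃ r : Circle, r ^ 4 ≠ 1 := by
    refine ⟨Circle.exp (Real.pi / 4), fun h => ?_⟩
    have h := congrArg (fun z : Circle => (z : ℂ)) h
    simp only [Circle.coe_pow, Circle.coe_exp, Circle.coe_one, ← Complex.exp_nat_mul] at h
    rw [show ((4 : ℕ) : ℂ) * (((Real.pi / 4 : ℝ) : ℂ) * Complex.I) = Real.pi * Complex.I by
      push_cast; ring, Complex.exp_pi_mul_I] at h
    norm_num at h
  obtain ⟨r, hr⟩ := hr
  let w : Fin L → Circle := fun k => if k = a ∨ k = -a then r else 1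
  have hw (k : Fin L) : evenPhase w k = if k = a ∨ k = -a then r ^ 2 else 1 := by
    have : (-k = a ∨ -k = -a) ↔ (k = a ∨ k = -a) := by
      rw [neg_inj, neg_eq_iff_eq_neg, or_comm]
    simp only [evenPhase, w, this]
    split_ifs
    · rw [sq]
    · simp
  have hh := h w
  rw [hw, hw, hw, hw, if_neg h1, if_neg h2, if_pos (Or.inl rfl), mul_one] at hh
  split_ifs at hh
  · exact hr (by rw [← hh, ← pow_add])
  · apply hr
    rw [mul_one] at hh
    rw [show 4 = 2 * 2 from rfl, pow_mul, hh, one_pow]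

theorem evenPhase_eq_of_eq_or_eq_neg {L : ℕ} [NeZero L] {a c : Fin L} (h : c = a ∨ c = -a)
    (w : Fin L → Circle) : evenPhase w c = evenPhase w a := by
  rcases h with rfl | rfl
  · rfl
  · exact evenPhase_neg w a

theorem Fin.eq_zero_of_add_self {L : ℕ} [NeZero L] (hL : Odd L) {k : Fin L} (h : k + k = 0) :
    k = 0 := by
  have h' := congrArg Fin.val h
  rw [Fin.val_add, Fin.val_zero] at h'
  obtain ⟨m, rfl⟩ := hL
  apply Fin.ext
  rw [Fin.val_zero]
  have := k.2
  obtain ⟨c, hc⟩ := Nat.dvd_of_mod_eq_zero h'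
  have : c < 2 := by
    by_contra! h2
    have := Nat.mul_le_mul_left (2 * m + 1) h2
    omega
  interval_cases c <;> omega

/-- Even phases determine momenta only up to sign, and the difference κ - μ has to settle the signs.
Flipping both would give 2(κ - μ) = 0; the pairs (κ, -κ) and (κ', -κ') would give 2κ = 2κ'. Oddness
of L makes doubling injective in both cases. -/
theorem eq_of_evenPhase_mul_eq {L : ℕ} [NeZero L] (hL : Odd L) {κ μ κ' μ' : Fin L} (hne : κ ≠ μ)
    (hs : κ - μ = κ' - μ') (h : ∀ w : Fin L → Circle,
      evenPhase w μ * evenPhase w κ' = evenPhase w μ' * evenPhase w κ) : κ = κ' ∧ μ = μ' := by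
  have fin1 (hκ : κ = κ') : κ = κ' ∧ μ = μ' := ⟨hκ, by subst hκ; exact sub_right_inj.1 hs⟩
  have fin2 (hμ : μ' = μ) : κ = κ' ∧ μ = μ' := ⟨by subst hμ; exact sub_left_inj.1 hs, hμ.symm⟩
  rcases evenPhase_eq_of_mul_eq h with h1 | h1
  · have h2 (w : Fin L → Circle) : evenPhase w κ' * evenPhase w 0 =
        evenPhase w κ * evenPhase w 0 := by
      have := h w
      rw [evenPhase_eq_of_eq_or_eq_neg h1 w] at this
      rw [mul_left_cancel this]
    rcases h1 with h1 | h1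
    · exact fin2 h1
    · have h3 : κ = κ' ∨ κ = -κ' := by
        -- Squaring makes the two alternatives of `evenPhase_eq_of_mul_eq` coincide.
        have h4 (w : Fin L → Circle) : evenPhase w κ' * evenPhase w κ' =
            evenPhase w κ * evenPhase w κ := by
          rw [mul_right_cancel (h2 w)]
        simpa using evenPhase_eq_of_mul_eq h4
      rcases h3 with h3 | h3
      · exact fin1 h3
      · refine absurd (sub_eq_zero.1 (Fin.eq_zero_of_add_self hL ?_)) hne
        nth_rewrite 2 [hs]
        rw [h1, h3]
        abel
  · have hκ : κ = -μ := h1.resolve_left hne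
    have h2 (w : Fin L → Circle) : evenPhase w κ' * evenPhase w κ' =
        evenPhase w μ' * evenPhase w μ' := by
      have := h w
      rw [evenPhase_eq_of_eq_or_eq_neg h1 w, mul_comm] at this
      rw [mul_right_cancel this]
    have h3 : μ' = κ' ∨ μ' = -κ' := by simpa using evenPhase_eq_of_mul_eq h2
    rcases h3 with h3 | h3
    · rw [h3, sub_self] at hs
      exact absurd (sub_eq_zero.1 hs) hne
    · apply fin1
      rw [← sub_eq_zero]
      apply Fin.eq_zero_of_add_self hL
      have : κ + κ = κ' + κ' := by
        rw [h3, sub_neg_eq_add] at hs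
        rw [← hs, show μ = -κ by rw [hκ, neg_neg], sub_neg_eq_add]
      rw [sub_add_sub_comm, this, sub_self]

/-- The dependence of `(uᴴ b u)_{pp}` on phases `w` and position `p`, for a single Fourier
coefficient of `b`. -/
noncomputable def pairCharacter {L : ℕ} [NeZero L] (q : Fin L × Fin L) :
    (Fin L → Circle) × Multiplicative (Fin L) →* ℂ where
  toFun g := dft L (q.1 - q.2) g.2.toAdd * star (evenPhase g.1 q.1 : ℂ) * (evenPhase g.1 q.2 : ℂ)
  map_one' := by simp [evenPhase, dft_symm _ 0, dft_zero]
  map_mul' g h := by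
    rw [Prod.snd_mul, toAdd_mul, dft_symm, dft_add, dft_symm, dft_symm _ (q.1 - q.2)]
    simp only [evenPhase, Prod.fst_mul, Pi.mul_apply, Circle.coe_mul, star_mul]
    ring

/-- Trivial phases expose the momentum difference, position 0 exposes the phase part. -/
theorem pairCharacter_injective {L : ℕ} [NeZero L] (hL : Odd L) {q r : Fin L × Fin L}
    (hq : q.1 ≠ q.2) (h : pairCharacter q = pairCharacter r) : q = r := by
  have hs : q.1 - q.2 = r.1 - r.2 := dft_injective fun k => by
    simpa [pairCharacter, evenPhase] using DFunLike.congr_fun h (1, Multiplicative.ofAdd k)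
  have hw (w : Fin L → Circle) : evenPhase w q.2 * evenPhase w r.1 =
      evenPhase w r.2 * evenPhase w q.1 := by
    have h1 := DFunLike.congr_fun h (w, 1)
    simp only [pairCharacter, MonoidHom.coe_mk, OneHom.coe_mk, toAdd_one, dft_symm _ 0, dft_zero,
      one_mul] at h1
    have h2 : (evenPhase w q.1)⁻¹ * evenPhase w q.2 = (evenPhase w r.1)⁻¹ * evenPhase w r.2 := by
      apply Circle.ext
      rw [Circle.coe_mul, Circle.coe_mul, Circle.coe_inv_eq_conj, Circle.coe_inv_eq_conj]
      exact h1
    rw [inv_mul_eq_iff_eq_mul] at h2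
    rw [h2, mul_assoc, mul_right_comm, inv_mul_cancel, one_mul, mul_comm]
  obtain ⟨h1, h2⟩ := eq_of_evenPhase_mul_eq hL hq hs hw
  exact Prod.ext h1 h2

theorem pairCharacter_diag {L : ℕ} [NeZero L] (k : Fin L) : pairCharacter (k, k) = 1 := by
  ext g
  simp [pairCharacter, dft_zero, mul_comm, Complex.mul_conj, Circle.normSq_coe]

theorem coeff_eq_zero_of_sum_pairCharacter {L : ℕ} [NeZero L] (hL : Odd L)
    (c : Fin L × Fin L → ℂ) (h : ∀ g, ∑ q, c q * pairCharacter q g = 0) :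
    (∀ q : Fin L × Fin L, q.1 ≠ q.2 → c q = 0) ∧ ∑ k, c (k, k) = 0 := by
  classical
  -- All diagonal pairs give the trivial character, so they are merged into the single index `none`.
  let χ : Option {q : Fin L × Fin L // q.1 ≠ q.2} →
      ((Fin L → Circle) × Multiplicative (Fin L) →* ℂ) :=
    fun o => o.elim 1 fun q => pairCharacter q.1
  have hχ : Function.Injective χ := by
    have h1 (q : {q : Fin L × Fin L // q.1 ≠ q.2}) : pairCharacter q.1 ≠ 1 := fun h => by
      rw [← pairCharacter_diag 0] at h
      exact q.2 (by rw [pairCharacter_injective hL q.2 h])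
    rintro (_ | q) (_ | r) hqr
    · rfl
    · exact absurd hqr.symm (h1 r)
    · exact absurd hqr (h1 q)
    · exact congrArg some (Subtype.ext (pairCharacter_injective hL q.2 hqr))
  have hli := (linearIndependent_monoidHom ((Fin L → Circle) × Multiplicative (Fin L)) ℂ).comp χ hχ
  rw [Fintype.linearIndependent_iff] at hli
  have key := hli (fun o => o.elim (∑ k, c (k, k)) fun q => c q.1) (by
    ext g
    rw [Pi.zero_apply, ← h g, Fintype.sum_option, Pi.add_apply, Finset.sum_apply]
    simp only [Pi.smul_apply, Function.comp_apply, smul_eq_mul, Option.elim, χ]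
    rw [← Fintype.sum_subtype_add_sum_subtype (fun q : Fin L × Fin L => q.1 ≠ q.2), add_comm]
    congr 1
    rw [MonoidHom.one_apply, mul_one]
    refine Finset.sum_bij' (fun k _ => ⟨(k, k), by simp⟩) (fun q _ => q.1.1) ?_ ?_ ?_ ?_ ?_
    · simp
    · simp
    · simp
    · rintro ⟨⟨i, j⟩, hq⟩ -
      simpa using hq
    · intro k _
      simp [pairCharacter_diag])
  exact ⟨fun q hq => key (some ⟨q, hq⟩), key none⟩

/-! ### Second quantization of one-particle matrices -/

/-- The operator `∑ b_{lm} a_l† a_m` belonging to a one-particle matrix `b`. -/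
def secondQuant (L : ℕ) : Matrix (Fin L) (Fin L) ℂ →ₗ[ℂ] FockOp L where
  toFun b := ∑ l, ∑ m, b l m • twoPoint l m
  map_add' b c := by simp [add_smul, Finset.sum_add_distrib]
  map_smul' z b := by simp [smul_smul, Finset.smul_sum]

theorem secondQuant_apply {L : ℕ} (b : Matrix (Fin L) (Fin L) ℂ) :
    secondQuant L b = ∑ l, ∑ m, b l m • twoPoint l m := rfl

theorem secondQuant_single {L : ℕ} (i j : Fin L) :
    secondQuant L (Matrix.single i j 1) = twoPoint i j := by
  rw [secondQuant_apply, Finset.sum_eq_single i, Finset.sum_eq_single j]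
  · simp
  · intro m _ hm
    simp [hm.symm]
  · simp
  · intro l _ hl
    simp [hl.symm]
  · simp

theorem range_secondQuant (L : ℕ) : LinearMap.range (secondQuant L) = W₂ L := by
  apply le_antisymm
  · rintro _ ⟨b, rfl⟩
    rw [secondQuant_apply, W₂]
    refine Submodule.sum_mem _ fun l _ => Submodule.sum_mem _ fun m _ => Submodule.smul_mem _ _ ?_
    exact Submodule.subset_span ⟨(l, m), rfl⟩
  · rw [W₂, Submodule.span_le]
    rintro _ ⟨⟨i, j⟩, rfl⟩
    exact ⟨Matrix.single i j 1, secondQuant_single i j⟩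

theorem rotCreat_mul_conjTranspose_rotCreat {L : ℕ} (u : Matrix (Fin L) (Fin L) ℂ) (l m : Fin L) :
    rotCreat u l * (rotCreat u m)ᴴ = ∑ p, ∑ q, (star (u l p) * u m q) • twoPoint p q := by
  rw [conjTranspose_rotCreat, rotCreat, Finset.sum_mul_sum]
  simp only [Matrix.smul_mul, Matrix.mul_smul, smul_smul, twoPoint, mul_comm (star _)]

theorem freeEvolution_conj_secondQuant {L : ℕ} {u : Matrix (Fin L) (Fin L) ℂ}
    (hu : u ∈ Matrix.unitaryGroup (Fin L) ℂ) (b : Matrix (Fin L) (Fin L) ℂ) :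
    freeEvolution u * secondQuant L b * (freeEvolution u)ᴴ = secondQuant L (uᴴ * b * u) := by
  have h (l m : Fin L) : freeEvolution u * twoPoint l m * (freeEvolution u)ᴴ =
      rotCreat u l * (rotCreat u m)ᴴ := by
    rw [twoPoint, ← Matrix.mul_assoc, freeEvolution_mul_creat, Matrix.mul_assoc (rotCreat u l),
      freeEvolution_mul_annih hu, Matrix.mul_assoc, Matrix.mul_assoc,
      freeEvolution_mul_conjTranspose hu, Matrix.mul_one]
  simp only [secondQuant_apply, Matrix.mul_sum, Matrix.sum_mul, Matrix.mul_smul, Matrix.smul_mul, h,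
    rotCreat_mul_conjTranspose_rotCreat, Finset.smul_sum, smul_smul]
  simp only [mul_apply, Finset.sum_mul, Finset.sum_smul, conjTranspose_apply]
  rw [Finset.sum_congr rfl fun l _ => Finset.sum_comm, Finset.sum_comm]
  refine Finset.sum_congr rfl fun p _ => ?_
  rw [Finset.sum_congr rfl fun l _ => Finset.sum_comm (t := Finset.univ), Finset.sum_comm]
  refine Finset.sum_congr rfl fun q _ => ?_
  rw [Finset.sum_comm]
  refine Finset.sum_congr rfl fun m _ => Finset.sum_congr rfl fun l _ => ?_
  congr 1
  ring

theorem freeEvolution_conj_secondQuant' {L : ℕ} {u : Matrix (Fin L) (Fin L) ℂ}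
    (hu : u ∈ Matrix.unitaryGroup (Fin L) ℂ) (d : Matrix (Fin L) (Fin L) ℂ) :
    (freeEvolution u)ᴴ * secondQuant L d * freeEvolution u = secondQuant L (u * d * uᴴ) := by
  have h1 : uᴴ * u = 1 := mem_unitaryGroup_iff'.1 hu
  have h2 := freeEvolution_mul_conjTranspose hu
  have h3 := mul_eq_one_comm.1 h2
  have h : d = uᴴ * (u * d * uᴴ) * u := by
    rw [Matrix.mul_assoc, Matrix.mul_assoc (u * d), h1, Matrix.mul_one, ← Matrix.mul_assoc, h1,
      Matrix.one_mul]
  rw [h, ← freeEvolution_conj_secondQuant hu, Matrix.mul_assoc, Matrix.mul_assoc, h3,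
    Matrix.mul_one, ← Matrix.mul_assoc, h3, Matrix.one_mul, ← h]

theorem twoPoint_apply_self {L : ℕ} (i j : Fin L) (n : Occ L) :
    (twoPoint i j) n n = if i = j ∧ n i = true then 1 else 0 := by
  rw [twoPoint, mul_annih_apply, ← Matrix.one_mul (creat i), mul_creat_apply]
  rcases eq_or_ne i j with rfl | hij
  · rw [jwSign_update_of_le le_rfl]
    cases h : n i
    · simp
    · have : Function.update (Function.update n i false) i true = n := by
        rw [Function.update_idem, ← h, Function.update_eq_self]
      simp only [Function.update_self, if_true, and_self]
      rw [this, Matrix.one_apply_eq, mul_one, jwSign_mul_self]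
  · rw [if_neg (show ¬(i = j ∧ n i = true) from fun h => hij h.1)]
    cases h : n j
    · simp
    · rw [Matrix.one_apply_ne, mul_zero, ite_self, mul_zero, ite_self]
      intro h'
      have := congrFun h' j
      rw [Function.update_of_ne hij.symm, Function.update_self, h] at this
      simp at this

theorem twoPoint_self_apply_of_ne {L : ℕ} (i : Fin L) {r n : Occ L} (h : r ≠ n) :
    (twoPoint i i) r n = 0 := by
  rw [twoPoint, mul_annih_apply, ← Matrix.one_mul (creat i), mul_creat_apply]
  cases hn : n i
  · simp
  · rw [Function.update_idem, ← hn, Function.update_eq_self, Matrix.one_apply_ne h]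
    simp

/-- Number operators are diagonal in the Fock basis, while a_i† a_j with i ≠ j has zero diagonal
there. -/
theorem sum_diag_smul_fockProj {L : ℕ} (d : Matrix (Fin L) (Fin L) ℂ) :
    ∑ n, secondQuant L d n n • fockProj n = secondQuant L (diagonal d.diag) := by
  ext r s
  rw [Matrix.sum_apply]
  simp only [secondQuant_apply, Matrix.sum_apply, Matrix.smul_apply, fockProj, smul_eq_mul,
    Matrix.single_apply, twoPoint_apply_self, diagonal_apply, diag_apply]
  rcases eq_or_ne r s with rfl | h
  · rw [Finset.sum_eq_single r]
    · rw [if_pos ⟨rfl, rfl⟩, mul_one]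
      refine Finset.sum_congr rfl fun i _ => Finset.sum_congr rfl fun j _ => ?_
      rw [twoPoint_apply_self]
      rcases eq_or_ne i j with rfl | hij
      · rw [if_pos rfl]
      · simp [hij]
    · intro n _ hn
      rw [if_neg fun h => hn h.1, mul_zero]
    · simp
  · rw [Finset.sum_eq_zero, eq_comm]
    · refine Finset.sum_eq_zero fun i _ => Finset.sum_eq_zero fun j _ => ?_
      split_ifs with hij
      · rw [← hij, twoPoint_self_apply_of_ne i h, mul_zero]
      · rw [zero_mul]
    · intro n _
      rw [if_neg, mul_zero]
      rintro ⟨rfl, rfl⟩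
      exact h rfl

/-! ### The channel on one-particle matrices -/

/-- Rotation by `u`, dephasing and rotating back. -/
def dephase {L : ℕ} (u b : Matrix (Fin L) (Fin L) ℂ) : Matrix (Fin L) (Fin L) ℂ :=
  u * diagonal (uᴴ * b * u).diag * uᴴ

theorem sum_channelTerm_secondQuant {L : ℕ} {u : Matrix (Fin L) (Fin L) ℂ}
    (hu : u ∈ Matrix.unitaryGroup (Fin L) ℂ) (b : Matrix (Fin L) (Fin L) ℂ) :
    ∑ n, channelTerm u n (secondQuant L b) = secondQuant L (dephase u b) := by
  rw [dephase, ← freeEvolution_conj_secondQuant' hu, ← sum_diag_smul_fockProj, Matrix.mul_sum,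
    Matrix.sum_mul]
  refine Finset.sum_congr rfl fun n _ => ?_
  rw [channelTerm, freeEvolution_conj_secondQuant hu, Matrix.mul_smul, Matrix.smul_mul]

theorem CUSym.continuous_coe (L : ℕ) [NeZero L] :
    Continuous fun u : CUSym L => (u.1.1 : Matrix (Fin L) (Fin L) ℂ) :=
  continuous_subtype_val.comp continuous_subtype_val

theorem integrable_dephase {L : ℕ} [NeZero L] (b : Matrix (Fin L) (Fin L) ℂ) (k l : Fin L) :
    Integrable (fun u : CUSym L => dephase u.1.1 b k l) (haarCUSym L) := by
  have h1 := CUSym.continuous_coe L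
  have h2 : Continuous fun u : CUSym L => dephase u.1.1 b k l := by
    unfold dephase
    have : Continuous fun u : CUSym L => (u.1.1ᴴ * b * u.1.1).diag := by fun_prop
    have := this.matrix_diagonal
    fun_prop
  simpa using h2.continuousOn.integrableOn_compact (μ := haarCUSym L) isCompact_univ

/-- The averaged dephasing of one-particle matrices. -/
noncomputable def coeffChannel (L : ℕ) [NeZero L] :
    Matrix (Fin L) (Fin L) ℂ →ₗ[ℂ] Matrix (Fin L) (Fin L) ℂ where
  toFun b := Matrix.of fun k l => ∫ u : CUSym L, dephase u.1.1 b k l ∂(haarCUSym L)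
  map_add' b c := by
    ext k l
    simp only [of_apply, Matrix.add_apply]
    rw [← integral_add (integrable_dephase b k l) (integrable_dephase c k l)]
    refine integral_congr_ae (Filter.Eventually.of_forall fun u => ?_)
    have hd (v w : Fin L → ℂ) : diagonal (v + w) = diagonal v + diagonal w :=
      (diagonal_add v w).symm
    simp only [dephase, Matrix.mul_add, Matrix.add_mul, diag_add, hd, Matrix.add_apply]
  map_smul' z b := by
    ext k l
    simp only [of_apply, Matrix.smul_apply, RingHom.id_apply, smul_eq_mul]
    rw [← integral_const_mul]
    refine integral_congr_ae (Filter.Eventually.of_forall fun u => ?_)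
    simp only [dephase, Matrix.mul_smul, Matrix.smul_mul, diag_smul, diagonal_smul]
    rfl

theorem coeffChannel_apply {L : ℕ} [NeZero L] (b : Matrix (Fin L) (Fin L) ℂ) (k l : Fin L) :
    coeffChannel L b k l = ∫ u : CUSym L, dephase u.1.1 b k l ∂(haarCUSym L) := rfl

theorem measurementChannel_secondQuant {L : ℕ} [NeZero L] (b : Matrix (Fin L) (Fin L) ℂ) :
    measurementChannel L (secondQuant L b) = secondQuant L (coeffChannel L b) := by
  ext r s
  change ∑ n : Occ L, ∫ u : CUSym L, channelTerm u.1.1 n (secondQuant L b) r s ∂(haarCUSym L) = _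
  rw [← integral_finsetSum _ fun n _ => integrable_channelTerm n _ r s]
  have h (u : CUSym L) : ∑ n, channelTerm u.1.1 n (secondQuant L b) r s =
      ∑ k, ∑ l, dephase u.1.1 b k l * twoPoint k l r s := by
    rw [← Matrix.sum_apply, sum_channelTerm_secondQuant u.1.2, secondQuant_apply]
    simp [Matrix.sum_apply]
  simp only [h]
  simp only [secondQuant_apply, Matrix.sum_apply, Matrix.smul_apply, smul_eq_mul]
  rw [integral_finsetSum _ fun k _ => integrable_finsetSum _ fun l _ =>
    (integrable_dephase b k l).mul_const _]
  refine Finset.sum_congr rfl fun k _ => ?_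
  rw [integral_finsetSum _ fun l _ => (integrable_dephase b k l).mul_const _]
  refine Finset.sum_congr rfl fun l _ => ?_
  rw [integral_mul_const, coeffChannel_apply]

/-- Matrices all of whose nontrivial cyclic diagonals sum to zero. -/
def zeroDiagonalSums (L : ℕ) [NeZero L] : Submodule ℂ (Matrix (Fin L) (Fin L) ℂ) where
  carrier := {b | ∀ k : Fin L, k ≠ 0 → ∑ i, b i (i + k) = 0}
  zero_mem' k _ := by simp
  add_mem' hb hc k hk := by simp [Finset.sum_add_distrib, hb k hk, hc k hk]
  smul_mem' z b hb k hk := by simp [← Finset.mul_sum, hb k hk]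

theorem dephase_mem_zeroDiagonalSums {L : ℕ} [NeZero L] (u : CUSym L)
    (b : Matrix (Fin L) (Fin L) ℂ) : dephase u.1.1 b ∈ zeroDiagonalSums L := by
  intro k hk
  have h1 (p : Fin L) : ∑ i, u.1.1 i p * star (u.1.1 (i + k) p) = 0 := by
    -- By circulance, shifting the row by `k` amounts to changing the column, so the sum is an inner
    -- product of columns `p` and `p + k`.
    have h2 : (u.1.1ᴴ * u.1.1) p (p + k) = 0 := by
      have : u.1.1ᴴ * u.1.1 = 1 := mem_unitaryGroup_iff'.1 u.1.2
      rw [this, Matrix.one_apply_ne]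
      simpa using hk
    rw [mul_apply, ← Equiv.sum_comp (Equiv.addRight k)] at h2
    rw [← h2]
    refine Finset.sum_congr rfl fun i _ => ?_
    rw [u.2.1 i p k, conjTranspose_apply, mul_comm]
    rfl
  simp only [dephase, mul_apply (M := _ * _) (N := _ᴴ), mul_diagonal, conjTranspose_apply]
  rw [Finset.sum_comm]
  refine Finset.sum_eq_zero fun p _ => ?_
  rw [← mul_zero ((u.1.1ᴴ * b * u.1.1).diag p), ← h1 p, Finset.mul_sum]
  refine Finset.sum_congr rfl fun i _ => ?_
  ring

theorem coeffChannel_mem_zeroDiagonalSums {L : ℕ} [NeZero L] (b : Matrix (Fin L) (Fin L) ℂ) :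
    coeffChannel L b ∈ zeroDiagonalSums L := by
  intro k hk
  simp only [coeffChannel_apply]
  rw [← integral_finsetSum _ fun i _ => integrable_dephase b i (i + k)]
  simp [dephase_mem_zeroDiagonalSums _ b k hk]

/-- Dephasing is positive semidefinite for the Hilbert-Schmidt product; this turns the kernel of the
average into a condition on each `u`. -/
theorem sum_star_mul_dephase {L : ℕ} (u b : Matrix (Fin L) (Fin L) ℂ) :
    ∑ k, ∑ l, star (b k l) * dephase u b k l =
      ((∑ p, ‖(uᴴ * b * u) p p‖ ^ 2 : ℝ) : ℂ) := by
  have h (p : Fin L) : star ((uᴴ * b * u) p p) =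
      ∑ k, ∑ l, star (b k l) * (u k p * star (u l p)) := by
    simp only [mul_apply, conjTranspose_apply, star_sum, Finset.sum_mul, star_mul', star_star]
    rw [Finset.sum_comm]
    refine Finset.sum_congr rfl fun k _ => Finset.sum_congr rfl fun l _ => ?_
    ring
  have h2 (p : Fin L) : ((‖(uᴴ * b * u) p p‖ ^ 2 : ℝ) : ℂ) =
      ∑ k, ∑ l, star (b k l) * (u k p * (uᴴ * b * u) p p * star (u l p)) := by
    rw [Complex.ofReal_pow, ← Complex.mul_conj', mul_comm]
    change star ((uᴴ * b * u) p p) * _ = _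
    rw [h, Finset.sum_mul]
    refine Finset.sum_congr rfl fun k _ => ?_
    rw [Finset.sum_mul]
    refine Finset.sum_congr rfl fun l _ => ?_
    ring
  rw [Complex.ofReal_sum]
  simp only [h2]
  symm
  rw [Finset.sum_comm]
  refine Finset.sum_congr rfl fun k _ => ?_
  rw [Finset.sum_comm]
  refine Finset.sum_congr rfl fun l _ => ?_
  rw [← Finset.mul_sum, dephase, mul_apply]
  simp only [mul_diagonal, conjTranspose_apply, diag_apply]

instance (L : ℕ) [NeZero L] : (haarCUSym L).IsOpenPosMeasure := by
  unfold haarCUSym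
  infer_instance

theorem diag_conj_eq_zero_of_coeffChannel_eq_zero {L : ℕ} [NeZero L]
    {b : Matrix (Fin L) (Fin L) ℂ} (h : coeffChannel L b = 0) (u : CUSym L) (p : Fin L) :
    (u.1.1ᴴ * b * u.1.1) p p = 0 := by
  set f : CUSym L → ℝ := fun u => ∑ p, ‖(u.1.1ᴴ * b * u.1.1) p p‖ ^ 2 with hf
  have hc : Continuous f := by
    have h1 := CUSym.continuous_coe L
    rw [hf]
    fun_prop
  have hint : ∫ u, f u ∂(haarCUSym L) = 0 := by
    rw [← Complex.ofReal_eq_zero, ← integral_complex_ofReal]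
    simp only [hf, ← sum_star_mul_dephase]
    rw [integral_finsetSum _ fun k _ => integrable_finsetSum _ fun l _ =>
      (integrable_dephase b k l).const_mul _]
    refine Finset.sum_eq_zero fun k _ => ?_
    rw [integral_finsetSum _ fun l _ => (integrable_dephase b k l).const_mul _]
    refine Finset.sum_eq_zero fun l _ => ?_
    rw [integral_const_mul, ← coeffChannel_apply, h, Matrix.zero_apply, mul_zero]
  have hi : Integrable f (haarCUSym L) := by
    simpa using hc.continuousOn.integrableOn_compact (μ := haarCUSym L) isCompact_univ
  rw [integral_eq_zero_iff_of_nonneg (fun u => Finset.sum_nonneg fun p _ => by positivity) hi]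
    at hint
  -- Haar measure charges every nonempty open set, so a continuous function vanishing almost
  -- everywhere vanishes everywhere.
  have h0 : ∑ p, ‖(u.1.1ᴴ * b * u.1.1) p p‖ ^ 2 = 0 :=
    congrFun ((hc.ae_eq_iff_eq (g := 0) _ continuous_const).1 hint) u
  rw [Finset.sum_eq_zero_iff_of_nonneg fun p _ => by positivity] at h0
  simpa using h0 p (Finset.mem_univ p)

theorem phaseCirculant_conj_apply_self {L : ℕ} [NeZero L] (w : Fin L → Circle)
    (b : Matrix (Fin L) (Fin L) ℂ) (p : Fin L) :
    ((phaseCirculant w)ᴴ * b * phaseCirculant w) p p = (L : ℂ)⁻¹ * (L : ℂ)⁻¹ *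
      ∑ q : Fin L × Fin L, ((dft L)ᴴ * b * dft L) q.1 q.2 *
        pairCharacter q (w, Multiplicative.ofAdd p) := by
  have h : (phaseCirculant w)ᴴ * b * phaseCirculant w = ((L : ℂ)⁻¹ * (L : ℂ)⁻¹) •
      (dft L * (diagonal (fun k => star (evenPhase w k : ℂ)) * ((dft L)ᴴ * b * dft L) *
        diagonal (fun k => (evenPhase w k : ℂ))) * (dft L)ᴴ) := by
    rw [phaseCirculant, conjTranspose_smul, conjTranspose_mul, conjTranspose_mul,
      conjTranspose_conjTranspose, diagonal_conjTranspose, Matrix.smul_mul, Matrix.smul_mul,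
      Matrix.mul_smul, smul_smul]
    simp only [Matrix.mul_assoc, star_inv₀, star_natCast]
    rfl
  rw [h, Matrix.smul_apply, smul_eq_mul, mul_apply, Fintype.sum_prod_type_right]
  congr 1
  refine Finset.sum_congr rfl fun l _ => ?_
  rw [mul_apply, Finset.sum_mul]
  refine Finset.sum_congr rfl fun k _ => ?_
  rw [mul_diagonal, diagonal_mul, conjTranspose_apply]
  simp only [pairCharacter, MonoidHom.coe_mk, OneHom.coe_mk, toAdd_ofAdd]
  rw [sub_eq_add_neg, dft_add, ← star_dft, dft_symm k, dft_symm l]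
  ring

/-- The diagonal Fourier coefficients are the Fourier transform of the cyclic diagonal sums, of
which only the trace survives. -/
theorem dft_conj_apply_self {L : ℕ} [NeZero L] {b : Matrix (Fin L) (Fin L) ℂ}
    (hb : b ∈ zeroDiagonalSums L) (k : Fin L) :
    ((dft L)ᴴ * b * dft L) k k = ∑ i, b i i := by
  have h : ((dft L)ᴴ * b * dft L) k k = ∑ s, dft L s k * ∑ i, b i (i + s) := by
    simp only [mul_apply, Finset.sum_mul, Finset.mul_sum, conjTranspose_apply, star_dft]
    rw [Finset.sum_comm, Finset.sum_comm (f := fun s i => dft L s k * b i (i + s))]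
    refine Finset.sum_congr rfl fun i _ => ?_
    rw [← Equiv.sum_comp (Equiv.addLeft i)]
    refine Finset.sum_congr rfl fun s _ => ?_
    have : dft L (-i) k * dft L i k = 1 := by rw [← dft_add, neg_add_cancel, dft_zero]
    rw [Equiv.coe_addLeft, dft_add]
    linear_combination (b i (i + s) * dft L s k) * this
  rw [h, Finset.sum_eq_single 0]
  · simp [dft_zero]
  · intro s _ hs
    rw [hb s hs, mul_zero]
  · simp

theorem eq_zero_of_coeffChannel_eq_zero {L : ℕ} [NeZero L] (hL : Odd L)
    {b : Matrix (Fin L) (Fin L) ℂ} (hb : b ∈ zeroDiagonalSums L) (h : coeffChannel L b = 0) :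
    b = 0 := by
  have hL0 : (L : ℂ) ≠ 0 := NeZero.ne _
  obtain ⟨h1, h2⟩ := coeff_eq_zero_of_sum_pairCharacter hL
    (fun q => ((dft L)ᴴ * b * dft L) q.1 q.2) fun g => by
      have := diag_conj_eq_zero_of_coeffChannel_eq_zero h (phaseCUSym g.1) g.2.toAdd
      have h3 := phaseCirculant_conj_apply_self g.1 b g.2.toAdd
      rw [show ((phaseCirculant g.1)ᴴ * b * phaseCirculant g.1) g.2.toAdd g.2.toAdd = 0 from this]
        at h3
      simpa [hL0] using h3.symm
  simp only [dft_conj_apply_self hb, Finset.sum_const, Finset.card_univ, Fintype.card_fin,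
    nsmul_eq_mul, mul_eq_zero, hL0, false_or] at h2
  have h3 : (dft L)ᴴ * b * dft L = 0 := by
    ext k l
    rcases eq_or_ne k l with rfl | hkl
    · rw [dft_conj_apply_self hb, h2, Matrix.zero_apply]
    · exact h1 (k, l) hkl
  have h4 : (L : ℂ) • (L : ℂ) • b = dft L * ((dft L)ᴴ * b * dft L) * (dft L)ᴴ := by
    rw [Matrix.mul_assoc, Matrix.mul_assoc, Matrix.mul_assoc, dft_mul_conjTranspose,
      ← Matrix.mul_assoc, dft_mul_conjTranspose]
    simp
  rw [h3, Matrix.mul_zero, Matrix.zero_mul] at h4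
  simpa [hL0] using h4

theorem range_coeffChannel {L : ℕ} [NeZero L] (hL : Odd L) :
    LinearMap.range (coeffChannel L) = zeroDiagonalSums L := by
  apply le_antisymm
  · rintro _ ⟨b, rfl⟩
    exact coeffChannel_mem_zeroDiagonalSums b
  · let f := (coeffChannel L).restrict (p := zeroDiagonalSums L) (q := zeroDiagonalSums L)
      fun b _ => coeffChannel_mem_zeroDiagonalSums b
    have hf : Function.Injective f := by
      rw [injective_iff_map_eq_zero]
      intro b hb
      exact Subtype.ext (eq_zero_of_coeffChannel_eq_zero hL b.2 (congrArg Subtype.val hb))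
    intro c hc
    obtain ⟨b, hb⟩ := LinearMap.injective_iff_surjective.1 hf ⟨c, hc⟩
    exact ⟨b.1, congrArg Subtype.val hb⟩

theorem imageTwoPoint_eq_map {L : ℕ} [NeZero L] (hL : Odd L) :
    imageTwoPoint L = (zeroDiagonalSums L).map (secondQuant L) := by
  rw [imageTwoPoint, LinearMap.range_domRestrict, ← range_secondQuant,
    ← range_coeffChannel hL, ← LinearMap.range_comp, ← LinearMap.range_comp]
  congr 1
  ext1 b
  exact measurementChannel_secondQuant b

/-! ### The basis -/

/-- The occupation numbers with a single particle in mode `i`. -/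
def singleOcc {L : ℕ} (i : Fin L) : Occ L := Function.update (vac L) i true

theorem singleOcc_injective {L : ℕ} : Function.Injective (singleOcc (L := L)) := by
  intro i j h
  by_contra hij
  have := congrFun h i
  rw [singleOcc, singleOcc, Function.update_self, Function.update_of_ne hij] at this
  simp [vac] at this

theorem jwSign_vac {L : ℕ} (i : Fin L) : jwSign i (vac L) = 1 := by
  simp [jwSign, vac]

theorem twoPoint_apply_singleOcc {L : ℕ} (k l i j : Fin L) :
    (twoPoint k l) (singleOcc i) (singleOcc j) = if k = i ∧ l = j then 1 else 0 := by
  rw [twoPoint, mul_annih_apply, ← Matrix.one_mul (creat k), mul_creat_apply]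
  rcases eq_or_ne l j with rfl | hl
  · have h1 : Function.update (singleOcc l) l false = vac L := by
      rw [singleOcc, Function.update_idem]
      exact Function.update_eq_self l (vac L)
    rw [h1, if_pos (by simp [singleOcc]), if_pos (show vac L k = false from rfl), singleOcc, jwSign_update_of_le le_rfl,
      jwSign_vac, jwSign_vac, one_mul, one_mul]
    change (1 : FockOp L) (singleOcc i) (singleOcc k) = _
    rw [Matrix.one_apply]
    simp only [singleOcc_injective.eq_iff, and_true, eq_comm]
  · rw [if_neg (by simp [singleOcc, vac, Function.update_of_ne hl]), if_neg fun h => hl h.2]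

theorem secondQuant_apply_singleOcc {L : ℕ} (b : Matrix (Fin L) (Fin L) ℂ) (i j : Fin L) :
    secondQuant L b (singleOcc i) (singleOcc j) = b i j := by
  simp only [secondQuant_apply, Matrix.sum_apply, Matrix.smul_apply, twoPoint_apply_singleOcc,
    smul_eq_mul]
  rw [Finset.sum_eq_single i, Finset.sum_eq_single j]
  · simp
  · intro m _ hm
    simp [hm]
  · simp
  · intro l _ hl
    simp [hl]
  · simp

theorem lastMode_add_one (L : ℕ) [NeZero L] : lastMode L + 1 = 0 := by
  apply Fin.ext
  have := NeZero.pos L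
  rw [Fin.val_add, Fin.val_zero, Fin.val_one', Nat.add_mod_mod]
  simp only [lastMode]
  rw [Nat.sub_add_cancel this, Nat.mod_self]

theorem sum_single_cyclic_diagonal {L : ℕ} [NeZero L] (i j k : Fin L) :
    ∑ l, Matrix.single i j (1 : ℂ) l (l + k) = if j = i + k then 1 else 0 := by
  rw [Finset.sum_eq_single i]
  · simp [Matrix.single_apply]
  · intro l _ hl
    simp [hl.symm]
  · simp

theorem basisOp_mem_map {L : ℕ} [NeZero L] (x : BasisIndex L) :
    basisOp x ∈ (zeroDiagonalSums L).map (secondQuant L) := by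
  rcases x with ⟨⟨i, j⟩, hi, hj⟩ | i
  · refine ⟨Matrix.single i j 1 - Matrix.single (lastMode L) (j - i - 1) 1, fun k _ => ?_, ?_⟩
    · simp only [Matrix.sub_apply, Finset.sum_sub_distrib, sum_single_cyclic_diagonal]
      -- Modulo L the last mode is -1, so the subtracted term lies on the same cyclic diagonal as
      -- (i, j).
      have : (j - i - 1 = lastMode L + k) ↔ j = i + k := by
        rw [eq_neg_of_add_eq_zero_left (lastMode_add_one L), neg_add_eq_sub, sub_left_inj,
          sub_eq_iff_eq_add']
      simp [this]
    · rw [map_sub, secondQuant_single, secondQuant_single, basisOp]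
  · refine ⟨Matrix.single i i 1, fun k hk => ?_, secondQuant_single i i⟩
    rw [sum_single_cyclic_diagonal, if_neg]
    simpa using hk

/-- The pair `(i, j)` such that only the basis operator with label `x` has `a_i† a_j` in its
expansion. -/
def leadingPair {L : ℕ} [NeZero L] : BasisIndex L → Fin L × Fin L
  | Sum.inl p => p.1
  | Sum.inr i => (i, i)

theorem basisOp_apply_singleOcc {L : ℕ} [NeZero L] (x y : BasisIndex L) :
    basisOp y (singleOcc (leadingPair x).1) (singleOcc (leadingPair x).2) =
      if x = y then 1 else 0 := by
  -- The subtracted term is an off-diagonal entry of the last row, and no leading pair is of that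
  -- kind.
  have hlast {i j : Fin L} (hij : j ≠ i) : j - i - 1 ≠ lastMode L := by
    rw [eq_neg_of_add_eq_zero_left (lastMode_add_one L), Ne, sub_eq_neg_self]
    exact sub_ne_zero.2 hij
  rcases x with ⟨⟨i, j⟩, hi, hj⟩ | i <;> rcases y with ⟨⟨k, l⟩, hk, hl⟩ | k <;>
    simp only [basisOp, leadingPair, Matrix.sub_apply, twoPoint_apply_singleOcc]
  · rw [if_neg (c := lastMode L = i ∧ _) fun h => hi h.1.symm, sub_zero]
    simp [eq_comm]
  · rw [if_neg, if_neg]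
    · simp
    · rintro ⟨rfl, rfl⟩
      exact hj rfl
  · rw [if_neg, if_neg, if_neg]
    · simp
    · simp
    · rintro ⟨h1, h2⟩
      exact hlast hl (h2.trans h1.symm)
    · rintro ⟨rfl, rfl⟩
      exact hl rfl
  · simp [eq_comm]

/-- Only the off-diagonal entries of the last row are not leading, and each is the sole remaining
term of its cyclic diagonal sum. -/
theorem eq_zero_of_leadingPair {L : ℕ} [NeZero L] {b : Matrix (Fin L) (Fin L) ℂ}
    (hb : b ∈ zeroDiagonalSums L)
    (h : ∀ x : BasisIndex L, b (leadingPair x).1 (leadingPair x).2 = 0) : b = 0 := by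
  ext i j
  rw [Matrix.zero_apply]
  rcases eq_or_ne j i with rfl | hji
  · exact h (Sum.inr j)
  rcases eq_or_ne i (lastMode L) with rfl | hi
  · have h0 := hb (j - lastMode L) (sub_ne_zero.2 hji)
    rw [Finset.sum_eq_single (lastMode L)] at h0
    · rwa [add_sub_cancel] at h0
    · intro i _ hi
      exact h (Sum.inl ⟨(i, i + (j - lastMode L)), hi, by simpa [sub_eq_zero] using hji⟩)
    · simp
  · exact h (Sum.inl ⟨(i, j), hi, hji⟩)

/-- The matrix entry between single-particle states at the leading pair, as a functional on
`imageTwoPoint L`. -/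
noncomputable def leadingCoeff {L : ℕ} [NeZero L] (x : BasisIndex L) :
    Module.Dual ℂ (imageTwoPoint L) :=
  (Matrix.entryLinearMap ℂ ℂ (singleOcc (leadingPair x).1) (singleOcc (leadingPair x).2)).comp
    (imageTwoPoint L).subtype

theorem dualBases_basisOp {L : ℕ} [NeZero L] (hL : Odd L) :
    Module.DualBases
      (fun x : BasisIndex L => (⟨basisOp x, imageTwoPoint_eq_map hL ▸ basisOp_mem_map x⟩ :
        imageTwoPoint L)) leadingCoeff where
  eval_same x := (basisOp_apply_singleOcc x x).trans (if_pos rfl)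
  eval_of_ne x y hxy := (basisOp_apply_singleOcc x y).trans (if_neg hxy)
  total {O P} h := by
    rw [← sub_eq_zero]
    have hmem : ((O - P : imageTwoPoint L) : FockOp L) ∈
        (zeroDiagonalSums L).map (secondQuant L) := imageTwoPoint_eq_map hL ▸ (O - P).2
    obtain ⟨b, hb, hbO⟩ := hmem
    have hb0 : b = 0 := eq_zero_of_leadingPair hb fun x => by
      rw [← secondQuant_apply_singleOcc b, hbO]
      exact sub_eq_zero.2 (h x)
    apply Subtype.ext
    rw [← hbO, hb0, map_zero]
    rfl

end FermionShadow

theorem mainTheorem2 (L : ℕ) [NeZero L] (hL : Odd L) :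
    (FermionShadow.imageTwoPoint L : Set (FermionShadow.FockOp L)) =
        {O | ∃ b : Fin L → Fin L → ℂ,
          O = ∑ l, ∑ m, b l m • FermionShadow.twoPoint l m ∧
          ∀ k : Fin L, k ≠ 0 → ∑ i, b i (i + k) = 0} ∧
      ∃ B : Module.Basis (FermionShadow.BasisIndex L) ℂ (FermionShadow.imageTwoPoint L),
        ∀ x, (B x : FermionShadow.FockOp L) = FermionShadow.basisOp x := by
  refine ⟨?_, (FermionShadow.dualBases_basisOp hL).basis, fun x => ?_⟩
  · rw [FermionShadow.imageTwoPoint_eq_map hL]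
    ext O
    constructor
    · rintro ⟨b, hb, rfl⟩
      exact ⟨b, rfl, hb⟩
    · rintro ⟨b, rfl, hb⟩
      exact ⟨b, hb, rfl⟩
  · rw [Module.DualBases.coe_basis]
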